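/- For an integer $q\ge 1$ let $I^q=[-1,1]^q$ and $\|g\|=\sup_{x\in I^q}|g(x)|$; for a class $V$ of functions let $\mathrm{dist}(f,V)=\inf_{P\in V}\|f-P\|$. For an integer $r\ge 1$ let $W_{r,q}$ be the set of all functions $f$ that have continuous partial derivatives of all orders up to $r$ on $I^q$ and satisfy $$\|f\|+\sum_{1\le |k|_1\le r}\|D^k f\|\le 1,$$ where $k$ runs over the multi-integers $k\in\mathbb{Z}_{\ge 0}^q$ and $|k|_1$ is the sum of the components of $k$. For $\sigma:\mathbb{R}\to\mathbb{R}$ and an integer $n\ge 1$ let $\mathcal{S}_n=\mathcal{S}_{n,q}$ be the class of all functions on $\mathbb{R}^q$ of the form $x\mapsto\sum_{k=1}^n a_k\,\sigma(w_k\cdot x+b_k)$ with $w_k\in\mathbb{R}^q$ and $a_k,b_k\in\mathbb{R}$. Let $T$ be a finite rooted binary tree in which every inner node has exactly two (ordered) children and every leaf is labelled by one of the variables $x_1,\dots,x_q$. A function with structure $T$ and constituents in a class $K$ of bivariate functions is a function of $(x_1,\dots,x_q)$ obtained by choosing a function $h_v\in K$ for each inner node $v$ of $T$ and evaluating the tree: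 a leaf outputs its variable, and an inner node $v$ outputs $h_v$ applied to the outputs of its two children. (For example, $f(x_1,\dots,x_4)=h_3(h_1(x_1,x_2),h_2(x_3,x_4))$.) Let $W_{T,r}$ be the class of functions with structure $T$ and constituents in $W_{r,2}$, and let $\mathcal{D}_n=\mathcal{D}_{n,T}$ be the class of functions with structure $T$ and constituents in $\mathcal{S}_{n,2}$. **Theorem.** Let $\sigma:\mathbb{R}\to\mathbb{R}$ be infinitely differentiable, and not a polynomial on any subinterval of $\mathbb{R}$ (of positive length). Let $r\ge 1$ be an integer. (a) For every $q\ge 1$ there is a constant $C$, depending only on $\sigma$, $r$ and $q$, such that for all $f\in W_{r,q}$ and all $n\ge 1$, $$\mathrm{dist}(f,\mathcal{S}_n)\le C\,n^{-r/q}.$$ (b) For every such tree $T$ there is a constant $C$, depending only on $\sigma$, $r$ and $T$, such that for all $f\in W_{T,r}$ and all $n\ge 1$, $$\mathrm{dist}(f,\mathcal{D}_n)\le C\,n^{-r/2}.$$ -/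

import Mathlib

open scoped ENNReal ContDiff

noncomputable section

namespace DeepNet

/-- The cube `[-1,1]^q`. -/
def cube (q : ℕ) : Set (Fin q → ℝ) := Set.Icc (fun _ => -1) (fun _ => 1)

/-- The uniform norm on the cube, with values in `[0,∞]`
(so that an unbounded function has norm `∞`). -/
def supNorm {q : ℕ} (g : (Fin q → ℝ) → ℝ) : ℝ≥0∞ := ⨆ x ∈ cube q, ‖g x‖ₑ

/-- The uniform distance on the cube from `f` to a class `V` of functions
(`∞` if `V` is empty). -/
def unifDist {q : ℕ} (f : (Fin q → ℝ) → ℝ) (V : Set ((Fin q → ℝ) → ℝ)) : ℝ≥0∞ :=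
  ⨅ P ∈ V, supNorm (fun x => f x - P x)

/-- The partial derivative in the `i`-th coordinate of a function on the cube
(one-sided at the two ends of the coordinate's interval). -/
def partialDeriv {q : ℕ} (i : Fin q) (f : (Fin q → ℝ) → ℝ) : (Fin q → ℝ) → ℝ :=
  fun x => derivWithin (fun t => f (Function.update x i t)) (Set.Icc (-1) 1) (x i)

/-- The mixed partial derivative `D^k f = ∂₀^{k₀} ∂₁^{k₁} ⋯ f` for a multi-integer `k`. -/
def multiDeriv {q : ℕ} (k : Fin q → ℕ) (f : (Fin q → ℝ) → ℝ) : (Fin q → ℝ) → ℝ :=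
  (List.finRange q).foldr (fun i g => (partialDeriv i)^[k i] g) f

/-- The functions that are `C^r` on the closed cube with
`‖f‖ + ∑_{1 ≤ |k|₁ ≤ r} ‖D^k f‖ ≤ 1`; the inner sum runs over all multi-integers `k`
with `|k|₁ = j`, and `j = 0` gives the term `‖f‖`.
Only the values of `f` on the cube matter. -/
def smoothBall (r q : ℕ) : Set ((Fin q → ℝ) → ℝ) :=
  {f | ContDiffOn ℝ r f (cube q) ∧
    ∑ j ∈ Finset.range (r + 1),
      ∑ k ∈ Finset.piAntidiag (Finset.univ : Finset (Fin q)) j,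
        supNorm (multiDeriv k f) ≤ 1}

/-- The shallow networks `x ↦ ∑_{k=1}^n a_k σ(w_k · x + b_k)` with `n` units on `ℝ^q`. -/
def shallow (σ : ℝ → ℝ) (n q : ℕ) : Set ((Fin q → ℝ) → ℝ) :=
  {P | ∃ (a : Fin n → ℝ) (w : Fin n → Fin q → ℝ) (b : Fin n → ℝ),
    P = fun x => ∑ k, a k * σ ((∑ i, w k i * x i) + b k)}

/-- Binary trees whose leaves carry input variables `x_i`, `i : Fin q`, and whose
inner nodes have exactly two children. -/
inductive BinTree (q : ℕ) : Type
  | leaf (i : Fin q) : BinTree q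
  | node (l r : BinTree q) : BinTree q

/-- The compositional functions with the structure of a given tree: a leaf passes its input
variable on, an inner node applies a bivariate constituent function from the class `K` to the
outputs of its two children. The constituents at different nodes are independent. -/
def compClass {q : ℕ} (K : Set ((Fin 2 → ℝ) → ℝ)) : BinTree q → Set ((Fin q → ℝ) → ℝ)
  | .leaf i => {fun x => x i}
  | .node l r => {f | ∃ h ∈ K, ∃ g₁ ∈ compClass K l, ∃ g₂ ∈ compClass K r,
      f = fun x => h ![g₁ x, g₂ x]}

end DeepNet

end

/-! Both parts rest on two facts: smooth functions are approximated well by polynomials, and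
polynomials are limits of networks whose size depends only on the degree.

Polynomial rate (`exists_coordPoly_approx`). With `x = cos θ`, values of `g` at equispaced angles
are averaged against a kernel: a high-degree Dirichlet kernel, which makes the quadrature exact,
times a power of a lower-degree one, which localizes to angular scale `1/L`. The average reproduces
Taylor polynomials, and the kernel moments of the remainder are of order `L ^ (-r)`. Applying the
resulting bounded operator in each variable gives degree `O(L)` per variable and error `O(L ^ (-r))`
on the cube.

Networks. By Baire, some `b` has all derivatives of `σ` nonzero (`exists_iteratedDeriv_ne_zero`).
Combinations of `σ(h p·x + b)` over lattice points `p ∈ {0,…,N}^q` isolate any monomial with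
exponents at most `N` as `h → 0` (`eventually_monomial_approx`). The inner weights do not depend on
the monomial, so `(N+1)^q` units serve every polynomial of coordinate degree `N`. Taking `N` of
order `n^(1/q)` gives (a).

For (b), constituents are 1-Lipschitz in each variable, so errors add up along the tree. Each
approximate constituent is rescaled so that its outputs stay in `[-1,1]`, where the next estimate
applies. -/

namespace DeepNet

open Real Finset

/-! ### Trigonometric quadrature -/

/-- The Dirichlet kernel `∑_{|k| ≤ L} cos (k u)`. -/
noncomputable def dirichlet (L : ℕ) (u : ℝ) : ℝ :=
  ∑ i ∈ range (2 * L + 1), cos (((i : ℝ) - L) * u)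

/-- The equispaced nodes `2πm/Q`. -/
noncomputable def node (Q m : ℕ) : ℝ := 2 * π * m / Q

/-- Multiplying by `2 sin(πk/Q)` makes the sum telescope over a full number of periods; `0 < |k| <
Q` keeps this factor nonzero. -/
theorem sum_cos_node {Q : ℕ} {k : ℤ} (c : ℝ) (hk : |k| < Q) :
    ∑ m ∈ range Q, cos (k * node Q m + c) = if k = 0 then Q * cos c else 0 := by
  split_ifs with h
  · simp [h]
  have hQ : (Q : ℝ) ≠ 0 := by
    rintro hQ
    have : (Q : ℤ) = 0 := by exact_mod_cast hQ
    have := abs_nonneg k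
    omega
  have hQ' : Q ≠ 0 := by exact_mod_cast hQ
  have hs : sin (π * k / Q) ≠ 0 := by
    rw [Ne, sin_eq_zero_iff]
    rintro ⟨n, hn⟩
    have h1 : (n : ℝ) * Q = k := by
      field_simp at hn
      nlinarith [pi_pos]
    have h2 : n * Q = k := by exact_mod_cast h1
    have hn0 : n ≠ 0 := by rintro rfl; simp at h2; omega
    rw [← h2, abs_mul] at hk
    have := Int.one_le_abs hn0
    have h4 : |(Q : ℤ)| = Q := abs_of_nonneg (by positivity)
    rw [h4] at hk
    nlinarith
  have key : ∀ m : ℕ, 2 * sin (π * k / Q) * cos (k * node Q m + c) =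
      sin (π * k / Q * (2 * ((m + 1 : ℕ) : ℝ) - 1) + c) - sin (π * k / Q * (2 * m - 1) + c) := by
    intro m
    have e1 : π * k / Q * (2 * ((m + 1 : ℕ) : ℝ) - 1) + c = (k * node Q m + c) + π * k / Q := by
      simp only [node]; push_cast; field_simp; ring
    have e2 : π * k / Q * (2 * (m : ℝ) - 1) + c = (k * node Q m + c) - π * k / Q := by
      simp only [node]; field_simp; ring
    rw [e1, e2, sin_add, sin_sub]; ring
  have : 2 * sin (π * k / Q) * ∑ m ∈ range Q, cos (k * node Q m + c) = 0 := by
    rw [mul_sum, sum_congr rfl fun m _ => key m,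
      sum_range_sub (fun m : ℕ => sin (π * k / Q * (2 * (m : ℝ) - 1) + c))]
    have : π * k / Q * (2 * (Q : ℝ) - 1) + c
        = (π * k / Q * (2 * ((0 : ℕ) : ℝ) - 1) + c) + k * (2 * π) := by
      push_cast; field_simp; ring
    rw [this, sin_add_int_mul_two_pi, sub_self]
  simpa [hs] using this

/-- Real trigonometric polynomials of degree at most `M`. -/
noncomputable def trigPoly (M : ℕ) : Submodule ℝ (ℝ → ℝ) :=
  Submodule.span ℝ {g | ∃ (k : ℤ) (c : ℝ), |k| ≤ M ∧ g = fun u => cos (k * u + c)}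

theorem cos_mem_trigPoly {M : ℕ} {k : ℤ} (c : ℝ) (hk : |k| ≤ M) :
    (fun u => cos (k * u + c)) ∈ trigPoly M :=
  Submodule.subset_span ⟨k, c, hk, rfl⟩

theorem trigPoly_mono {M N : ℕ} (h : M ≤ N) : trigPoly M ≤ trigPoly N := by
  refine Submodule.span_mono ?_
  rintro g ⟨k, c, hk, rfl⟩
  exact ⟨k, c, hk.trans (by exact_mod_cast h), rfl⟩

theorem const_mem_trigPoly (M : ℕ) (a : ℝ) : (fun _ => a) ∈ trigPoly M := by
  have := (trigPoly M).smul_mem a (cos_mem_trigPoly (M := M) (k := 0) 0 (by simp))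
  convert this using 1
  ext; simp

theorem mul_mem_trigPoly {M N : ℕ} {f g : ℝ → ℝ} (hf : f ∈ trigPoly M) (hg : g ∈ trigPoly N) :
    f * g ∈ trigPoly (M + N) := by
  induction hf using Submodule.span_induction with
  | zero => simp
  | add x y _ _ hx hy => rw [add_mul]; exact add_mem hx hy
  | smul a x _ hx => rw [smul_mul_assoc]; exact Submodule.smul_mem _ a hx
  | mem x hx =>
    obtain ⟨k, c, hk, rfl⟩ := hx
    induction hg using Submodule.span_induction with
    | zero => simp
    | add x y _ _ hx hy => rw [mul_add]; exact add_mem hx hy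
    | smul a x _ hx => rw [mul_smul_comm]; exact Submodule.smul_mem _ a hx
    | mem x hx =>
      obtain ⟨l, d, hl, rfl⟩ := hx
      have h1 : |k + l| ≤ ((M + N : ℕ) : ℤ) := by
        push_cast; exact (abs_add_le _ _).trans (add_le_add hk hl)
      have h2 : |k - l| ≤ ((M + N : ℕ) : ℤ) := by
        push_cast; exact (abs_sub _ _).trans (add_le_add hk hl)
      have := Submodule.smul_mem _ (1 / 2 : ℝ)
        (add_mem (cos_mem_trigPoly (c + d) h1) (cos_mem_trigPoly (c - d) h2))
      convert this using 1
      ext u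
      simp only [Pi.mul_apply, Pi.smul_apply, Pi.add_apply, smul_eq_mul]
      have e1 : ((k + l : ℤ) : ℝ) * u + (c + d) = (k * u + c) + (l * u + d) := by push_cast; ring
      have e2 : ((k - l : ℤ) : ℝ) * u + (c - d) = (k * u + c) - (l * u + d) := by push_cast; ring
      rw [e1, e2, cos_add (_ + _) (_ + _), cos_sub (_ + _) (_ + _)]; ring

theorem pow_mem_trigPoly {M : ℕ} {f : ℝ → ℝ} (hf : f ∈ trigPoly M) (n : ℕ) :
    f ^ n ∈ trigPoly (n * M) := by
  induction n with
  | zero => rw [pow_zero, zero_mul]; exact const_mem_trigPoly 0 1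
  | succ n ih => rw [pow_succ, Nat.succ_mul]; exact mul_mem_trigPoly ih hf

theorem dirichlet_sub_mem_trigPoly (L : ℕ) (θ : ℝ) :
    (fun u => dirichlet L (θ - u)) ∈ trigPoly L := by
  have : (fun u => dirichlet L (θ - u)) = ∑ i ∈ range (2 * L + 1),
      fun u => cos (((-((i : ℤ) - L) : ℤ) : ℝ) * u + ((i : ℝ) - L) * θ) := by
    ext u
    rw [Finset.sum_apply, dirichlet]
    refine sum_congr rfl fun i _ => ?_
    push_cast; congr 1; ring
  rw [this]
  refine sum_mem fun i hi => cos_mem_trigPoly _ ?_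
  rw [mem_range] at hi
  rw [abs_le]; constructor <;> omega

/-- Discrete convolution with the Dirichlet kernel reproduces trigonometric polynomials. -/
theorem sum_dirichlet_mul {Q M : ℕ} (hQ : 2 * M < Q) {S : ℝ → ℝ} (hS : S ∈ trigPoly M) (θ : ℝ) :
    ∑ m ∈ range Q, dirichlet M (θ - node Q m) * S (node Q m) = Q * S θ := by
  induction hS using Submodule.span_induction with
  | zero => simp
  | add x y _ _ hx hy => simp only [Pi.add_apply, mul_add, sum_add_distrib, hx, hy]
  | smul a x _ hx =>
    simp only [Pi.smul_apply, smul_eq_mul, mul_left_comm _ a, ← mul_sum, hx]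
  | mem x hx =>
    obtain ⟨j, c, hj, rfl⟩ := hx
    rw [abs_le] at hj
    have step : ∀ m : ℕ, dirichlet M (θ - node Q m) * cos (j * node Q m + c) =
        ∑ i ∈ range (2 * M + 1), (1 / 2 : ℝ) *
          (cos (((j - ((i : ℤ) - M) : ℤ) : ℝ) * node Q m + (((i : ℝ) - M) * θ + c)) +
           cos (((-((i : ℤ) - M) - j : ℤ) : ℝ) * node Q m + (((i : ℝ) - M) * θ - c))) := by
      intro m
      rw [dirichlet, sum_mul]
      refine sum_congr rfl fun i _ => ?_
      push_cast
      have e1 : ((j : ℝ) - (i - M)) * node Q m + ((i - M) * θ + c) =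
        ((i : ℝ) - M) * (θ - node Q m) + (j * node Q m + c) := by ring
      have e2 : (-((i : ℝ) - M) - j) * node Q m + ((i - M) * θ - c) =
        ((i : ℝ) - M) * (θ - node Q m) - (j * node Q m + c) := by ring
      rw [e1, e2, cos_add (_ * _) (_ + _), cos_sub (_ * _) (_ + _)]; ring
    simp only [step]
    rw [sum_comm]
    simp only [← mul_sum, sum_add_distrib]
    -- Exactly one frequency `i - M` equals `j` and exactly one equals `-j`; each contributes half
    -- of the result. Since `2 * M < Q`, no other frequency is aliased to zero.
    have A : ∀ i ∈ range (2 * M + 1),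
        ∑ m ∈ range Q, cos (((j - ((i : ℤ) - M) : ℤ) : ℝ) * node Q m + (((i : ℝ) - M) * θ + c))
        = if i = (j + M).toNat then Q * cos (j * θ + c) else 0 := by
      intro i hi
      rw [mem_range] at hi
      rw [sum_cos_node _ (by rw [abs_lt]; constructor <;> omega)]
      by_cases h : i = (j + M).toNat
      · have : (i : ℤ) - M = j := by omega
        have h' : (i : ℝ) - M = j := by exact_mod_cast this
        rw [if_pos (by omega), if_pos h, h']
      · rw [if_neg (by omega), if_neg h]
    have B : ∀ i ∈ range (2 * M + 1),
        ∑ m ∈ range Q, cos (((-((i : ℤ) - M) - j : ℤ) : ℝ) * node Q m + (((i : ℝ) - M) * θ - c))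
        = if i = (-j + M).toNat then Q * cos (j * θ + c) else 0 := by
      intro i hi
      rw [mem_range] at hi
      rw [sum_cos_node _ (by rw [abs_lt]; constructor <;> omega)]
      by_cases h : i = (-j + M).toNat
      · have : (i : ℤ) - M = -j := by omega
        have h' : (i : ℝ) - M = -j := by exact_mod_cast this
        rw [if_pos (by omega), if_pos h, h', ← cos_neg]; congr 2; ring
      · rw [if_neg (by omega), if_neg h]
    rw [sum_congr rfl A, sum_congr rfl B, sum_ite_eq', sum_ite_eq', if_pos, if_pos]
    · ring
    · rw [mem_range]; omega
    · rw [mem_range]; omega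

theorem dirichlet_zero (L : ℕ) : dirichlet L 0 = 2 * L + 1 := by
  simp [dirichlet]

theorem abs_dirichlet_le (L : ℕ) (u : ℝ) : |dirichlet L u| ≤ 2 * L + 1 := by
  refine (abs_sum_le_sum_abs _ _).trans ?_
  refine (sum_le_sum fun i _ => abs_cos_le_one _).trans ?_
  simp

theorem abs_dirichlet_mul_sin_le (L : ℕ) (u : ℝ) : |dirichlet L u * sin (u / 2)| ≤ 1 := by
  have key : 2 * (dirichlet L u * sin (u / 2)) =
      sin ((((2 * L + 1 : ℕ) : ℝ) - L - 1 / 2) * u) - sin ((((0 : ℕ) : ℝ) - L - 1 / 2) * u) := by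
    rw [← sum_range_sub (fun i : ℕ => sin (((i : ℝ) - L - 1 / 2) * u)), dirichlet, sum_mul, mul_sum]
    refine sum_congr rfl fun i _ => ?_
    have e1 : (((i + 1 : ℕ) : ℝ) - L - 1 / 2) * u = ((i : ℝ) - L) * u + u / 2 := by
      push_cast; ring
    have e2 : ((i : ℝ) - L - 1 / 2) * u = ((i : ℝ) - L) * u - u / 2 := by ring
    rw [e1, e2, sin_add, sin_sub]; ring
  have h1 := abs_le.1 (abs_sin_le_one ((((2 * L + 1 : ℕ) : ℝ) - L - 1 / 2) * u))
  have h2 := abs_le.1 (abs_sin_le_one ((((0 : ℕ) : ℝ) - L - 1 / 2) * u))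
  rw [abs_le]; constructor <;> linarith

/-- Discrete Parseval: the reproducing formula applied to the kernel itself. -/
theorem sum_dirichlet_sq {Q L : ℕ} (hQ : 2 * L < Q) (θ : ℝ) :
    ∑ m ∈ range Q, dirichlet L (θ - node Q m) ^ 2 = Q * (2 * L + 1) := by
  have := sum_dirichlet_mul hQ (dirichlet_sub_mem_trigPoly L θ) θ
  simpa [pow_two, dirichlet_zero] using this

theorem abs_cos_sub_cos_le (x y : ℝ) : |cos x - cos y| ≤ 2 * |sin ((x - y) / 2)| := by
  rw [cos_sub_cos, abs_mul, abs_mul]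
  have := abs_sin_le_one ((x + y) / 2)
  have := abs_nonneg (sin ((x - y) / 2))
  norm_num
  nlinarith

/-! ### The localized kernel -/

/-- A normalized power of the Dirichlet kernel. -/
noncomputable def localizer (r L : ℕ) (u : ℝ) : ℝ := (dirichlet L u / (2 * L + 1)) ^ (r + 2)

theorem localizer_zero (r L : ℕ) : localizer r L 0 = 1 := by
  rw [localizer, dirichlet_zero, div_self (by positivity), one_pow]

/-- This explains the exponent `r + 2`: up to `r` factors absorb the powers of `|cos x - cos y|`,
and two remain so that the sum over nodes is controlled by `sum_dirichlet_sq`. -/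
theorem abs_localizer_mul_le (r L : ℕ) {j : ℕ} (hj : j ≤ r) (x y : ℝ) :
    |localizer r L (x - y)| * |cos x - cos y| ^ j ≤
      (2 / (2 * L + 1)) ^ j * (dirichlet L (x - y) / (2 * L + 1)) ^ 2 := by
  have hL : (0 : ℝ) < 2 * L + 1 := by positivity
  set d := |dirichlet L (x - y) / (2 * L + 1)| with hd
  have d0 : 0 ≤ d := abs_nonneg _
  have d1 : d ≤ 1 := by
    rw [hd, abs_div, abs_of_pos hL, div_le_one hL]; exact abs_dirichlet_le _ _
  have d2 : d * |cos x - cos y| ≤ 2 / (2 * L + 1) := by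
    have h1 := abs_dirichlet_mul_sin_le L (x - y)
    rw [abs_mul] at h1
    rw [hd, abs_div, abs_of_pos hL, div_mul_eq_mul_div, div_le_div_iff_of_pos_right hL]
    calc _ ≤ |dirichlet L (x - y)| * (2 * |sin ((x - y) / 2)|) := by
          gcongr; exact abs_cos_sub_cos_le x y
      _ ≤ 2 := by linarith
  have e : |localizer r L (x - y)| = d ^ (r - j) * d ^ j * d ^ 2 := by
    rw [localizer, abs_pow, ← pow_add, ← pow_add]; congr 1; omega
  rw [e, ← sq_abs (dirichlet L (x - y) / (2 * L + 1)), ← hd]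
  calc d ^ (r - j) * d ^ j * d ^ 2 * |cos x - cos y| ^ j
      = d ^ (r - j) * ((d * |cos x - cos y|) ^ j * d ^ 2) := by rw [mul_pow]; ring
    _ ≤ 1 * ((2 / (2 * L + 1)) ^ j * d ^ 2) := by
        gcongr; exact pow_le_one₀ d0 d1
    _ = _ := one_mul _

/-- Number of quadrature nodes. -/
def numNodes (r L : ℕ) : ℕ := 2 * ((r + 2) * L + r) + 1

/-- The quadrature weight of the kernel at angular distance `u`. -/
noncomputable def kernel (r L : ℕ) (u : ℝ) : ℝ :=
  dirichlet ((r + 2) * L + r) u * localizer r L u / numNodes r L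

theorem abs_kernel_le (r L : ℕ) (u : ℝ) : |kernel r L u| ≤ |localizer r L u| := by
  have hQ : (0 : ℝ) < numNodes r L := by simp only [numNodes]; positivity
  rw [kernel, abs_div, abs_mul, abs_of_pos hQ, div_le_iff₀ hQ, mul_comm]
  gcongr
  refine (abs_dirichlet_le _ _).trans (le_of_eq ?_)
  simp [numNodes]

theorem sum_abs_kernel_mul_le (r L : ℕ) {j : ℕ} (hj : j ≤ r) (θ : ℝ) :
    ∑ m ∈ range (numNodes r L), |kernel r L (θ - node (numNodes r L) m)| *
        |cos θ - cos (node (numNodes r L) m)| ^ j ≤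
      (2 * r + 3) * (2 / (2 * L + 1)) ^ j := by
  have hL : (0 : ℝ) < 2 * L + 1 := by positivity
  calc _ ≤ ∑ m ∈ range (numNodes r L), (2 / (2 * L + 1) : ℝ) ^ j *
        (dirichlet L (θ - node (numNodes r L) m) / (2 * L + 1) : ℝ) ^ 2 := by
        refine sum_le_sum fun m _ => le_trans ?_ (abs_localizer_mul_le r L hj _ _)
        exact mul_le_mul_of_nonneg_right (abs_kernel_le _ _ _) (by positivity)
    _ = (2 / (2 * L + 1) : ℝ) ^ j * (numNodes r L / (2 * L + 1)) := by
        simp only [div_pow _ (2 * (L : ℝ) + 1) 2]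
        rw [← mul_sum, ← sum_div, sum_dirichlet_sq]
        · congr 1; field_simp
        · simp only [numNodes]; nlinarith [Nat.zero_le (r * L)]
    _ ≤ _ := by
        rw [mul_comm]
        gcongr
        rw [div_le_iff₀ hL]
        simp only [numNodes]; push_cast
        nlinarith [mul_nonneg (Nat.cast_nonneg (α := ℝ) r) (Nat.cast_nonneg (α := ℝ) L),
          Nat.cast_nonneg (α := ℝ) L]

/-- The localizer times the `j`-th power has degree at most `(r + 2) * L + r`, so the outer
Dirichlet kernel reproduces it exactly. Only its value at `θ` remains, and the localizer equals 1
there. -/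
theorem sum_kernel_mul_pow (r L : ℕ) {j : ℕ} (hj : j ≤ r) (θ : ℝ) :
    ∑ m ∈ range (numNodes r L), kernel r L (θ - node (numNodes r L) m) *
        (cos (node (numNodes r L) m) - cos θ) ^ j = 0 ^ j := by
  have hQ : (0 : ℝ) < numNodes r L := by simp only [numNodes]; positivity
  have h1 : (fun u => cos u - cos θ) ∈ trigPoly 1 := by
    have := sub_mem (cos_mem_trigPoly (M := 1) (k := 1) 0 (by simp)) (const_mem_trigPoly 1 (cos θ))
    convert this using 1
    ext; simp
  have h2 : (fun u => localizer r L (θ - u)) ∈ trigPoly ((r + 2) * L) := by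
    have := pow_mem_trigPoly
      (Submodule.smul_mem _ (1 / (2 * L + 1) : ℝ) (dirichlet_sub_mem_trigPoly L θ)) (r + 2)
    convert this using 1
    ext; simp [localizer]; ring
  have h3 := mul_mem_trigPoly h2 (pow_mem_trigPoly h1 j)
  have h4 := sum_dirichlet_mul (Q := numNodes r L) (M := (r + 2) * L + r) (by simp [numNodes])
    (trigPoly_mono (by omega) h3) θ
  simp only [Pi.mul_apply, Pi.pow_apply, sub_self, localizer_zero, one_mul] at h4
  rw [← mul_right_inj' hQ.ne', ← h4, mul_sum]
  refine sum_congr rfl fun m _ => ?_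
  rw [kernel]; field_simp

end DeepNet

/-! ### Even trigonometric polynomials as algebraic polynomials in the cosine -/

namespace DeepNet

open Real Finset

/-- Symmetrizing in `θ` leaves only multiples of `cos (k * θ)`, which are Chebyshev polynomials of
`cos θ`. -/
theorem exists_poly_of_mem_trigPoly {N : ℕ} {S : ℝ → ℝ} (hS : S ∈ trigPoly N) (φ : ℝ) :
    ∃ p : Polynomial ℝ, p.natDegree ≤ N ∧
      ∀ θ, S (θ - φ) + S (-θ - φ) = p.eval (cos θ) := by
  induction hS using Submodule.span_induction with
  | zero => exact ⟨0, by simp, by simp⟩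
  | add x y _ _ hx hy =>
    obtain ⟨p, hp, hp'⟩ := hx
    obtain ⟨q, hq, hq'⟩ := hy
    refine ⟨p + q, Polynomial.natDegree_add_le_of_degree_le hp hq, fun θ => ?_⟩
    rw [Polynomial.eval_add, ← hp', ← hq', Pi.add_apply, Pi.add_apply]; ring
  | smul a x _ hx =>
    obtain ⟨p, hp, hp'⟩ := hx
    refine ⟨a • p, (Polynomial.natDegree_smul_le _ _).trans hp, fun θ => ?_⟩
    rw [Polynomial.eval_smul, ← hp', Pi.smul_apply, Pi.smul_apply, smul_add]
  | mem x hx =>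
    obtain ⟨k, c, hk, rfl⟩ := hx
    refine ⟨(2 * cos (c - k * φ)) • Polynomial.Chebyshev.T ℝ k,
      (Polynomial.natDegree_smul_le _ _).trans ?_, fun θ => ?_⟩
    · rw [Polynomial.Chebyshev.natDegree_T]
      rw [Int.abs_eq_natAbs] at hk; omega
    · rw [Polynomial.eval_smul, Polynomial.Chebyshev.T_real_cos, smul_eq_mul]
      have e1 : k * (θ - φ) + c = k * θ + (c - k * φ) := by ring
      have e2 : k * (-θ - φ) + c = (c - k * φ) - k * θ := by ring
      simp only [e1, e2]
      rw [cos_add, cos_sub (c - k * φ)]; ring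

theorem kernel_mem_trigPoly (r L : ℕ) : kernel r L ∈ trigPoly (2 * (r + 2) * L + r) := by
  have h : ∀ L, dirichlet L ∈ trigPoly L := fun L => by
    convert dirichlet_sub_mem_trigPoly L 0 using 1
    ext u; simp [dirichlet, cos_neg]
  have h2 := pow_mem_trigPoly (Submodule.smul_mem _ (1 / (2 * L + 1) : ℝ) (h L)) (r + 2)
  have h3 := Submodule.smul_mem _ (1 / numNodes r L : ℝ) (mul_mem_trigPoly (h ((r + 2) * L + r)) h2)
  have e : (r + 2) * L + r + (r + 2) * L = 2 * (r + 2) * L + r := by ring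
  rw [e] at h3
  convert h3 using 1
  ext; simp [kernel, localizer]; ring

/-! ### Approximation in one variable -/

/-- The derivative of the Taylor polynomial with respect to its centre collapses to a single term,
so the mean value inequality applies; the factor `1 / n!` is simply bounded by 1. -/
theorem exists_taylor_bound {n : ℕ} {g : ℝ → ℝ} (hg : ContDiffOn ℝ (n + 1 : ℕ) g (Set.Icc (-1) 1))
    (hb : ∀ x ∈ Set.Icc (-1 : ℝ) 1, |iteratedDerivWithin (n + 1) g (Set.Icc (-1) 1) x| ≤ 1)
    {x₀ : ℝ} (hx₀ : x₀ ∈ Set.Icc (-1 : ℝ) 1) :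
    ∃ a : ℕ → ℝ, a 0 = g x₀ ∧ ∀ x ∈ Set.Icc (-1 : ℝ) 1,
      |g x - ∑ k ∈ range (n + 1), a k * (x - x₀) ^ k| ≤ |x - x₀| ^ (n + 1) := by
  refine ⟨fun k => (k.factorial : ℝ)⁻¹ * iteratedDerivWithin k g (Set.Icc (-1) 1) x₀, by simp,
    fun x hx => ?_⟩
  have hsub : Set.uIcc x₀ x ⊆ Set.Icc (-1) 1 := Set.uIcc_subset_Icc hx₀ hx
  have hu : UniqueDiffOn ℝ (Set.Icc (-1 : ℝ) 1) := uniqueDiffOn_Icc (by norm_num)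
  have hd : DifferentiableOn ℝ (iteratedDerivWithin n g (Set.Icc (-1) 1)) (Set.Icc (-1) 1) :=
    hg.differentiableOn_iteratedDerivWithin (by exact_mod_cast Nat.lt_succ_self n) hu
  have hder : ∀ z ∈ Set.uIcc x₀ x, HasDerivWithinAt
      (fun z => taylorWithinEval g n (Set.Icc (-1) 1) z x)
      (((n.factorial : ℝ)⁻¹ * (x - z) ^ n) • iteratedDerivWithin (n + 1) g (Set.Icc (-1) 1) z)
      (Set.uIcc x₀ x) z := fun z hz =>
    (hasDerivWithinAt_taylorWithinEval_at_Icc x (by norm_num) (hsub hz)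
      (hg.of_le (by exact_mod_cast Nat.le_succ n)) hd).mono hsub
  have hbound : ∀ z ∈ Set.uIcc x₀ x, ‖((n.factorial : ℝ)⁻¹ * (x - z) ^ n) •
      iteratedDerivWithin (n + 1) g (Set.Icc (-1) 1) z‖ ≤ |x - x₀| ^ n := by
    intro z hz
    have h1 : |x - z| ≤ |x - x₀| := by
      rw [abs_sub_comm x x₀, Set.uIcc_comm] at *
      rw [abs_sub_comm x₀ x]
      exact (abs_sub_comm _ _).trans_le (Set.abs_sub_left_of_mem_uIcc hz |>.trans_eq (abs_sub_comm _ _))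
    have h2 : ((n.factorial : ℝ)⁻¹) ≤ 1 :=
      inv_le_one_of_one_le₀ (by exact_mod_cast n.factorial_pos)
    rw [norm_smul, norm_mul, norm_pow, norm_inv]
    simp only [Real.norm_eq_abs, Nat.abs_cast]
    calc _ ≤ 1 * |x - x₀| ^ n * 1 := by
          gcongr; exact hb z (hsub hz)
      _ = _ := by ring
  have := (convex_uIcc x₀ x).norm_image_sub_le_of_norm_hasDerivWithin_le hder hbound
    Set.left_mem_uIcc Set.right_mem_uIcc
  rw [taylorWithinEval_self, taylor_within_apply, Real.norm_eq_abs, Real.norm_eq_abs,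
    ← pow_succ] at this
  convert this using 5
  rw [smul_eq_mul]; ring

/-- The kernel sum is exact on the Taylor polynomial at `cos θ`, so only the remainder contributes,
through the kernel moment of order `n + 1`. -/
theorem abs_sub_sum_kernel_le {n L : ℕ} {g : ℝ → ℝ}
    (hg : ContDiffOn ℝ (n + 1 : ℕ) g (Set.Icc (-1) 1))
    (hb : ∀ x ∈ Set.Icc (-1 : ℝ) 1, |iteratedDerivWithin (n + 1) g (Set.Icc (-1) 1) x| ≤ 1)
    (θ : ℝ) :
    |g (cos θ) - ∑ m ∈ range (numNodes (n + 1) L), kernel (n + 1) L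
      (θ - node (numNodes (n + 1) L) m) * g (cos (node (numNodes (n + 1) L) m))| ≤
      (2 * (n + 1 : ℕ) + 3) * (2 / (2 * L + 1)) ^ (n + 1) := by
  obtain ⟨a, ha, h⟩ := exists_taylor_bound hg hb (cos_mem_Icc θ)
  have e : g (cos θ) = ∑ m ∈ range (numNodes (n + 1) L), kernel (n + 1) L
      (θ - node (numNodes (n + 1) L) m) * ∑ k ∈ range (n + 1),
        a k * (cos (node (numNodes (n + 1) L) m) - cos θ) ^ k := by
    simp only [mul_sum, mul_left_comm _ (a _)]
    rw [sum_comm]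
    simp only [← mul_sum]
    rw [sum_congr rfl fun k hk => by
      rw [sum_kernel_mul_pow (n + 1) L (mem_range.1 hk).le]]
    rw [sum_range_succ']
    simp [ha]
  rw [e, ← sum_sub_distrib]
  refine (abs_sum_le_sum_abs _ _).trans ((sum_le_sum fun m _ => ?_).trans
    (sum_abs_kernel_mul_le (n + 1) L le_rfl θ))
  rw [← mul_sub, abs_mul, abs_sub_comm, abs_sub_comm (cos θ)]
  exact mul_le_mul_of_nonneg_left (h _ (cos_mem_Icc _)) (abs_nonneg _)

/-- Linear approximation operators, built from finitely many point evaluations, that are uniformly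
bounded and attain the optimal order `L ^ (-r)` with polynomials of degree `O(L)`. -/
theorem exists_jackson_operator {r : ℕ} (hr : 1 ≤ r) : ∃ C : ℝ, 0 ≤ C ∧ ∀ L : ℕ,
    ∃ (Q : ℕ) (l : ℕ → Polynomial ℝ) (t : ℕ → ℝ),
      (∀ m, (l m).natDegree ≤ 2 * (r + 2) * L + r) ∧ (∀ m, t m ∈ Set.Icc (-1 : ℝ) 1) ∧
      (∀ x ∈ Set.Icc (-1 : ℝ) 1, ∑ m ∈ range Q, |(l m).eval x| ≤ C) ∧
      ∀ g : ℝ → ℝ, ContDiffOn ℝ r g (Set.Icc (-1) 1) →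
        (∀ x ∈ Set.Icc (-1 : ℝ) 1, |iteratedDerivWithin r g (Set.Icc (-1) 1) x| ≤ 1) →
        ∀ x ∈ Set.Icc (-1 : ℝ) 1,
          |g x - ∑ m ∈ range Q, (l m).eval x * g (t m)| ≤ C / ((L : ℝ) + 1) ^ r := by
  obtain ⟨n, rfl⟩ : ∃ n, r = n + 1 := ⟨r - 1, by omega⟩
  refine ⟨(2 * (n + 1 : ℕ) + 3) * 2 ^ (n + 1), by positivity, fun L => ?_⟩
  set Q := numNodes (n + 1) L with hQ
  choose p hp hpe using fun m => exists_poly_of_mem_trigPoly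
    (kernel_mem_trigPoly (n + 1) L) (node Q m)
  -- Averaging over `θ` and `-θ` makes the weights polynomials in `cos θ` and leaves the target `g
  -- (cos θ)` unchanged.
  have hl : ∀ m θ, ((1 / 2 : ℝ) • p m).eval (cos θ) =
      (kernel (n + 1) L (θ - node Q m) + kernel (n + 1) L (-θ - node Q m)) / 2 := by
    intro m θ
    rw [Polynomial.eval_smul, ← hpe, smul_eq_mul]; ring
  have hx : ∀ x ∈ Set.Icc (-1 : ℝ) 1, ∃ θ, cos θ = x := fun x hx =>
    ⟨arccos x, cos_arccos hx.1 hx.2⟩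
  refine ⟨Q, fun m => (1 / 2 : ℝ) • p m, fun m => cos (node Q m),
    fun m => (Polynomial.natDegree_smul_le _ _).trans (hp m), fun m => cos_mem_Icc _, ?_, ?_⟩
  · intro x hx'
    obtain ⟨θ, rfl⟩ := hx x hx'
    have h1 := sum_abs_kernel_mul_le (n + 1) L (Nat.zero_le _) θ
    have h2 := sum_abs_kernel_mul_le (n + 1) L (Nat.zero_le _) (-θ)
    simp only [pow_zero, mul_one, ← hQ] at h1 h2
    have h3 : ∑ m ∈ range Q, |((1 / 2 : ℝ) • p m).eval (cos θ)| ≤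
        ∑ m ∈ range Q, (|kernel (n + 1) L (θ - node Q m)| +
          |kernel (n + 1) L (-θ - node Q m)|) / 2 := by
      refine sum_le_sum fun m _ => ?_
      rw [hl, abs_div, abs_two]
      gcongr; exact abs_add_le _ _
    rw [← sum_div, sum_add_distrib] at h3
    have h4 : (1 : ℝ) ≤ 2 ^ (n + 1) := one_le_pow₀ (by norm_num)
    have h5 : (0 : ℝ) ≤ 2 * (n + 1 : ℕ) + 3 := by positivity
    nlinarith
  · intro g hg hb x hx'
    obtain ⟨θ, rfl⟩ := hx x hx'
    have h1 := abs_le.1 (abs_sub_sum_kernel_le (L := L) hg hb θ)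
    have h2 := abs_le.1 (abs_sub_sum_kernel_le (L := L) hg hb (-θ))
    rw [cos_neg] at h2
    have e : ∑ m ∈ range Q, ((1 / 2 : ℝ) • p m).eval (cos θ) * g (cos (node Q m)) =
        (∑ m ∈ range Q, kernel (n + 1) L (θ - node Q m) * g (cos (node Q m)) +
         ∑ m ∈ range Q, kernel (n + 1) L (-θ - node Q m) * g (cos (node Q m))) / 2 := by
      rw [← sum_add_distrib, sum_div]
      refine sum_congr rfl fun m _ => ?_
      rw [hl]; ring
    have h3 : (2 * (n + 1 : ℕ) + 3) * (2 / (2 * L + 1) : ℝ) ^ (n + 1) ≤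
        (2 * (n + 1 : ℕ) + 3) * 2 ^ (n + 1) / ((L : ℝ) + 1) ^ (n + 1) := by
      rw [mul_div_assoc, ← div_pow]
      gcongr
      linarith [Nat.cast_nonneg (α := ℝ) L]
    refine le_trans ?_ h3
    rw [e, abs_le]; constructor <;> linarith

end DeepNet

namespace DeepNet

open Finset

/-! ### Approximation by polynomials in several variables -/

theorem update_mem_cube {q : ℕ} {x : Fin q → ℝ} (hx : x ∈ cube q) (i : Fin q) {t : ℝ}
    (ht : t ∈ Set.Icc (-1 : ℝ) 1) : Function.update x i t ∈ cube q := by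
  refine ⟨fun j => ?_, fun j => ?_⟩ <;> rcases eq_or_ne j i with rfl | h
  · simpa using ht.1
  · simpa [h] using hx.1 j
  · simpa using ht.2
  · simpa [h] using hx.2 j

theorem apply_mem_of_mem_cube {q : ℕ} {x : Fin q → ℝ} (hx : x ∈ cube q) (i : Fin q) :
    x i ∈ Set.Icc (-1 : ℝ) 1 := ⟨hx.1 i, hx.2 i⟩

theorem abs_le_of_supNorm_le {q : ℕ} {g : (Fin q → ℝ) → ℝ} (h : supNorm g ≤ 1) {x : Fin q → ℝ}
    (hx : x ∈ cube q) : |g x| ≤ 1 := by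
  have h1 : ‖g x‖ₑ ≤ 1 := (le_iSup₂ (f := fun x (_ : x ∈ cube q) => ‖g x‖ₑ) x hx).trans h
  rw [← Real.norm_eq_abs]
  rwa [← ofReal_norm, ENNReal.ofReal_le_one] at h1

theorem unifDist_le {q : ℕ} {f P : (Fin q → ℝ) → ℝ} {V : Set ((Fin q → ℝ) → ℝ)} (hP : P ∈ V)
    {ε : ℝ} (h : ∀ x ∈ cube q, |f x - P x| ≤ ε) : unifDist f V ≤ ENNReal.ofReal ε := by
  refine (iInf₂_le P hP).trans (iSup₂_le fun x hx => ?_)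
  rw [← ofReal_norm]
  exact ENNReal.ofReal_le_ofReal (h x hx)

/-! ### One-variable slices of functions in the smoothness ball -/

section smoothBall

variable {r q : ℕ} {f : (Fin q → ℝ) → ℝ}

theorem supNorm_multiDeriv_le (hf : f ∈ smoothBall r q) {k : Fin q → ℕ} (hk : ∑ i, k i ≤ r) :
    supNorm (multiDeriv k f) ≤ 1 := by
  refine le_trans ?_ hf.2
  have h1 : k ∈ piAntidiag (univ : Finset (Fin q)) (∑ i, k i) := by simp
  refine le_trans ?_ (single_le_sum (f := fun j => ∑ k ∈ piAntidiag (univ : Finset (Fin q)) j,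
    supNorm (multiDeriv k f)) (fun _ _ => zero_le) (mem_range.2 (Nat.lt_succ_of_le hk)))
  exact single_le_sum (f := fun k => supNorm (multiDeriv k f)) (fun _ _ => zero_le) h1

theorem iterate_partialDeriv (i : Fin q) (n : ℕ) (x : Fin q → ℝ) :
    (partialDeriv i)^[n] f x =
      iteratedDerivWithin n (fun t => f (Function.update x i t)) (Set.Icc (-1) 1) (x i) := by
  induction n generalizing x with
  | zero => simp
  | succ n ih =>
    rw [Function.iterate_succ_apply', partialDeriv, iteratedDerivWithin_succ]
    congr 1
    ext t
    rw [ih]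
    simp

theorem multiDeriv_single (i : Fin q) (n : ℕ) :
    multiDeriv (Pi.single i n) f = (partialDeriv i)^[n] f := by
  have key : ∀ l : List (Fin q), l.Nodup →
      l.foldr (fun j g => (partialDeriv j)^[(Pi.single i n : Fin q → ℕ) j] g) f =
        if i ∈ l then (partialDeriv i)^[n] f else f := by
    intro l hl
    induction l with
    | nil => simp
    | cons j l ih =>
      rw [List.nodup_cons] at hl
      rw [List.foldr_cons, ih hl.2]
      rcases eq_or_ne j i with rfl | h
      · simp [hl.1]
      · simp [h, h.symm]
  rw [multiDeriv, key _ (List.nodup_finRange q), if_pos (List.mem_finRange i)]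

theorem contDiffOn_slice (hf : f ∈ smoothBall r q) {x : Fin q → ℝ} (hx : x ∈ cube q) (i : Fin q) :
    ContDiffOn ℝ r (fun t => f (Function.update x i t)) (Set.Icc (-1) 1) :=
  hf.1.comp (contDiff_update _ x i).contDiffOn fun _ ht => update_mem_cube hx i ht

theorem abs_iteratedDerivWithin_slice_le (hf : f ∈ smoothBall r q) {x : Fin q → ℝ}
    (hx : x ∈ cube q) (i : Fin q) {n : ℕ} (hn : n ≤ r) {t : ℝ} (ht : t ∈ Set.Icc (-1 : ℝ) 1) :
    |iteratedDerivWithin n (fun t => f (Function.update x i t)) (Set.Icc (-1) 1) t| ≤ 1 := by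
  have h := abs_le_of_supNorm_le (supNorm_multiDeriv_le hf (k := Pi.single i n) (by simpa))
    (update_mem_cube hx i ht)
  rw [multiDeriv_single, iterate_partialDeriv] at h
  simpa using h

theorem abs_le_one_of_mem_smoothBall (hf : f ∈ smoothBall r q) {x : Fin q → ℝ}
    (hx : x ∈ cube q) : |f x| ≤ 1 := by
  have h := abs_le_of_supNorm_le (supNorm_multiDeriv_le hf (k := 0) (by simp)) hx
  have e : multiDeriv 0 f = f := by
    rw [multiDeriv]
    induction List.finRange q with
    | nil => rfl
    | cons j l ih => rw [List.foldr_cons, ih]; rfl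
  rwa [e] at h

theorem abs_sub_update_le (hr : 1 ≤ r) (hf : f ∈ smoothBall r q) {x : Fin q → ℝ}
    (hx : x ∈ cube q) (i : Fin q) {s t : ℝ} (hs : s ∈ Set.Icc (-1 : ℝ) 1)
    (ht : t ∈ Set.Icc (-1 : ℝ) 1) :
    |f (Function.update x i s) - f (Function.update x i t)| ≤ |s - t| := by
  have hd := (contDiffOn_slice hf hx i).differentiableOn (by simp; omega)
  have := (convex_Icc (-1 : ℝ) 1).norm_image_sub_le_of_norm_derivWithin_le hd (C := 1)
    (fun z hz => by
      have := abs_iteratedDerivWithin_slice_le hf hx i hr hz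
      rwa [iteratedDerivWithin_one] at this) ht hs
  simpa using this

end smoothBall

/-- The operator `g ↦ ∑ ℓ_m g(t_m)` acting on the `i`-th variable. -/
noncomputable def coordOp {q : ℕ} (Q : ℕ) (l : ℕ → Polynomial ℝ) (t : ℕ → ℝ) (i : Fin q)
    (f : (Fin q → ℝ) → ℝ) : (Fin q → ℝ) → ℝ :=
  fun x => ∑ m ∈ range Q, (l m).eval (x i) * f (Function.update x i (t m))

/-- Polynomials in the variables indexed by `s`, of degree at most `N` in each variable. -/
noncomputable def coordPoly {q : ℕ} (N : ℕ) (s : Finset (Fin q)) :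
    Submodule ℝ ((Fin q → ℝ) → ℝ) :=
  Submodule.span ℝ {g | ∃ k : Fin q → ℕ, (∀ i, k i ≤ N) ∧ g = fun x => ∏ i ∈ s, x i ^ k i}

theorem eval_mul_mem_coordPoly {q N : ℕ} {s : Finset (Fin q)} {i : Fin q} (hi : i ∉ s)
    {p : Polynomial ℝ} (hp : p.natDegree ≤ N) {g : (Fin q → ℝ) → ℝ} (hg : g ∈ coordPoly N s) :
    (fun x => p.eval (x i) * g x) ∈ coordPoly N (insert i s) := by
  induction hg using Submodule.span_induction with
  | zero => simp only [Pi.zero_apply, mul_zero]; exact Submodule.zero_mem _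
  | add x y _ _ hx hy => simp only [Pi.add_apply, mul_add]; exact add_mem hx hy
  | smul a x _ hx =>
    simp only [Pi.smul_apply, smul_eq_mul, mul_left_comm _ a]
    exact Submodule.smul_mem _ a hx
  | mem g hg =>
    obtain ⟨k, hk, rfl⟩ := hg
    have : (fun x : Fin q → ℝ => p.eval (x i) * ∏ j ∈ s, x j ^ k j) =
        ∑ n ∈ range (N + 1), p.coeff n •
          fun x : Fin q → ℝ => ∏ j ∈ insert i s, x j ^ Function.update k i n j := by
      ext x
      rw [Finset.sum_apply, Polynomial.eval_eq_sum_range' (Nat.lt_succ_of_le hp), sum_mul]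
      refine sum_congr rfl fun n _ => ?_
      rw [Pi.smul_apply, smul_eq_mul, prod_insert hi, Function.update_self, mul_assoc]
      congr 2
      refine prod_congr rfl fun j hj => ?_
      rw [Function.update_of_ne (fun h : j = i => hi (h ▸ hj))]
    rw [this]
    refine sum_mem fun n hn => Submodule.smul_mem _ _ (Submodule.subset_span ⟨_, fun j => ?_, rfl⟩)
    rcases eq_or_ne j i with rfl | h
    · simpa using Nat.lt_succ_iff.1 (mem_range.1 hn)
    · simpa [h] using hk j

/-- Variables not yet processed are frozen at `y`. The operator evaluates `f` at nodes in coordinate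
`i`, which only changes the frozen point; hence the hypothesis for all `y`. -/
theorem piecewise_coordOp_mem_coordPoly {q N Q : ℕ} {l : ℕ → Polynomial ℝ} {t : ℕ → ℝ}
    (hl : ∀ m, (l m).natDegree ≤ N) {s : Finset (Fin q)} {i : Fin q} (hi : i ∉ s)
    {f : (Fin q → ℝ) → ℝ} (hf : ∀ y, (fun x => f (s.piecewise x y)) ∈ coordPoly N s)
    (y : Fin q → ℝ) :
    (fun x => coordOp Q l t i f ((insert i s).piecewise x y)) ∈ coordPoly N (insert i s) := by
  have : (fun x => coordOp Q l t i f ((insert i s).piecewise x y)) =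
      ∑ m ∈ range Q, fun x =>
        (l m).eval (x i) * f (s.piecewise x (Function.update y i (t m))) := by
    ext x
    rw [Finset.sum_apply, coordOp]
    refine sum_congr rfl fun m _ => ?_
    congr 2
    · simp
    · ext j
      rcases eq_or_ne j i with rfl | h
      · simp [hi]
      · by_cases hj : j ∈ s <;> simp [Finset.piecewise, h, hj]
  rw [this]
  exact sum_mem fun m _ => eval_mul_mem_coordPoly hi (hl m) (hf _)

theorem foldr_coordOp_mem_coordPoly {q N Q : ℕ} {l : ℕ → Polynomial ℝ} {t : ℕ → ℝ}
    (hl : ∀ m, (l m).natDegree ≤ N) (f : (Fin q → ℝ) → ℝ) :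
    (List.finRange q).foldr (coordOp Q l t) f ∈ coordPoly N univ := by
  have key : ∀ L : List (Fin q), L.Nodup → ∀ y,
      (fun x => L.foldr (coordOp Q l t) f (L.toFinset.piecewise x y)) ∈
        coordPoly N L.toFinset := by
    intro L hL
    induction L with
    | nil =>
      intro y
      have := Submodule.smul_mem (coordPoly N (∅ : Finset (Fin q))) (f y)
        (Submodule.subset_span ⟨0, fun _ => Nat.zero_le _, rfl⟩)
      rw [List.toFinset_nil]
      convert this using 1
      ext x; simp
    | cons i L ih =>
      rw [List.nodup_cons] at hL
      rw [List.toFinset_cons]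
      exact piecewise_coordOp_mem_coordPoly hl (by simpa using hL.1) (ih hL.2)
  have h := key _ (List.nodup_finRange q) 0
  have e : (List.finRange q).toFinset = univ := by ext; simp
  rw [e] at h
  simpa using h

/-- Jackson's theorem on the cube. -/
theorem exists_coordPoly_approx {r : ℕ} (hr : 1 ≤ r) (q : ℕ) : ∃ C : ℝ, 0 ≤ C ∧
    ∀ f ∈ smoothBall r q, ∀ L : ℕ, ∃ P ∈ coordPoly (q := q) (2 * (r + 2) * L + r) univ,
      ∀ x ∈ cube q, |f x - P x| ≤ C / ((L : ℝ) + 1) ^ r := by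
  obtain ⟨C, hC, h⟩ := exists_jackson_operator hr
  -- In the induction the Jackson estimate is applied only to `f` itself; the error of the inner
  -- operators is multiplied by the uniform bound `C`. No smoothness of partially processed
  -- functions is needed.
  have key : ∀ I : List (Fin q), ∃ D : ℝ, 0 ≤ D ∧ ∀ f ∈ smoothBall r q, ∀ (L Q : ℕ)
      (l : ℕ → Polynomial ℝ) (t : ℕ → ℝ), (∀ m, t m ∈ Set.Icc (-1 : ℝ) 1) →
      (∀ x ∈ Set.Icc (-1 : ℝ) 1, ∑ m ∈ range Q, |(l m).eval x| ≤ C) →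
      (∀ g : ℝ → ℝ, ContDiffOn ℝ r g (Set.Icc (-1) 1) →
        (∀ x ∈ Set.Icc (-1 : ℝ) 1, |iteratedDerivWithin r g (Set.Icc (-1) 1) x| ≤ 1) →
        ∀ x ∈ Set.Icc (-1 : ℝ) 1,
          |g x - ∑ m ∈ range Q, (l m).eval x * g (t m)| ≤ C / ((L : ℝ) + 1) ^ r) →
      ∀ x ∈ cube q, |f x - I.foldr (coordOp Q l t) f x| ≤ D / ((L : ℝ) + 1) ^ r := by
    intro I
    induction I with
    | nil => exact ⟨0, le_rfl, by simp⟩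
    | cons i I ih =>
      obtain ⟨D, hD, ih⟩ := ih
      refine ⟨C + C * D, by positivity, fun f hf L Q l t ht hl hg x hx => ?_⟩
      have h1 := hg _ (contDiffOn_slice hf hx i)
        (fun z hz => abs_iteratedDerivWithin_slice_le hf hx i le_rfl hz) (x i)
        (apply_mem_of_mem_cube hx i)
      rw [Function.update_eq_self] at h1
      have h2 : |∑ m ∈ range Q, (l m).eval (x i) * f (Function.update x i (t m)) -
          ∑ m ∈ range Q, (l m).eval (x i) *
            I.foldr (coordOp Q l t) f (Function.update x i (t m))| ≤
          C * (D / ((L : ℝ) + 1) ^ r) := by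
        rw [← sum_sub_distrib]
        refine (abs_sum_le_sum_abs _ _).trans ?_
        refine le_trans ?_ (mul_le_mul_of_nonneg_right (hl (x i) (apply_mem_of_mem_cube hx i))
          (by positivity))
        rw [sum_mul]
        refine sum_le_sum fun m _ => ?_
        rw [← mul_sub, abs_mul]
        exact mul_le_mul_of_nonneg_left
          (ih f hf L Q l t ht hl hg _ (update_mem_cube hx i (ht m))) (abs_nonneg _)
      have h3 := (abs_sub_le _ _ _).trans (add_le_add h1 h2)
      rw [List.foldr_cons]
      refine h3.trans (le_of_eq ?_)
      ring
  obtain ⟨D, hD, key⟩ := key (List.finRange q)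
  refine ⟨D, hD, fun f hf L => ?_⟩
  obtain ⟨Q, l, t, hd, ht, hl, hg⟩ := h L
  exact ⟨_, foldr_coordOp_mem_coordPoly hd f, key f hf L Q l t ht hl hg⟩

end DeepNet

namespace DeepNet

open Finset Filter Topology

/-! ### Polynomials as limits of shallow networks -/

theorem exists_poly_of_iteratedDeriv_eq_zero {σ : ℝ → ℝ} (hσ : ContDiff ℝ ∞ σ) {n : ℕ} {a b : ℝ}
    (hab : a < b) (h : ∀ x ∈ Set.Ioo a b, iteratedDeriv n σ x = 0) :
    ∃ p : Polynomial ℝ, ∀ x ∈ Set.Ioo a b, σ x = p.eval x := by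
  obtain _ | n := n
  · exact ⟨0, by simpa using h⟩
  obtain ⟨x₀, hx₀⟩ := Set.nonempty_Ioo.2 hab
  refine ⟨∑ k ∈ range (n + 1), Polynomial.C ((k.factorial : ℝ)⁻¹ * iteratedDeriv k σ x₀) *
    (Polynomial.X - Polynomial.C x₀) ^ k, fun x hx => ?_⟩
  rcases eq_or_ne x₀ x with rfl | hne
  · simp [Polynomial.eval_finsetSum, sum_range_succ']
  obtain ⟨y, hy, e⟩ := taylor_mean_remainder_lagrange_iteratedDeriv (n := n) hne
    (hσ.of_le (by exact_mod_cast le_top)).contDiffOn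
  have hy' : y ∈ Set.Ioo a b := by
    have := Set.uIoo_subset_uIcc_self hy
    exact Set.OrdConnected.uIcc_subset Set.ordConnected_Ioo hx₀ hx this
  rw [h y hy', zero_mul, zero_div, sub_eq_zero, taylor_within_apply] at e
  rw [e, Polynomial.eval_finsetSum]
  refine sum_congr rfl fun k _ => ?_
  rw [iteratedDerivWithin_eq_iteratedDeriv (uniqueDiffOn_uIcc hne)
    (hσ.of_le (by exact_mod_cast le_top)).contDiffAt Set.left_mem_uIcc]
  simp only [Polynomial.eval_mul, Polynomial.eval_C, Polynomial.eval_pow, Polynomial.eval_sub,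
    Polynomial.eval_X, smul_eq_mul]
  ring

/-- A smooth function that is nowhere locally a polynomial has a point at which no derivative
vanishes. -/
theorem exists_iteratedDeriv_ne_zero {σ : ℝ → ℝ} (hσ : ContDiff ℝ ∞ σ)
    (hpoly : ∀ a b : ℝ, a < b → ¬ ∃ p : Polynomial ℝ, ∀ x ∈ Set.Ioo a b, σ x = p.eval x) :
    ∃ b : ℝ, ∀ n : ℕ, iteratedDeriv n σ b ≠ 0 := by
  by_contra! hcon
  have hc : ∀ n : ℕ, IsClosed {b | iteratedDeriv n σ b = 0} := fun n =>
    isClosed_eq (hσ.continuous_iteratedDeriv n (by exact_mod_cast le_top)) continuous_const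
  -- Baire: countably many closed zero sets cover the line, so one of them contains an interval, on
  -- which `σ` would be a polynomial.
  obtain ⟨n, x, hx⟩ := nonempty_interior_of_iUnion_of_closed hc
    (Set.eq_univ_of_forall fun b => Set.mem_iUnion.2 (hcon b))
  obtain ⟨ε, hε, hs⟩ := Metric.isOpen_iff.1 isOpen_interior x hx
  rw [Real.ball_eq_Ioo] at hs
  exact hpoly _ _ (by linarith) (exists_poly_of_iteratedDeriv_eq_zero hσ (n := n)
    (a := x - ε) (b := x + ε) (by linarith) fun y hy => by
      have := interior_subset (hs hy)
      exact this)

/-- The Vandermonde matrix of the nodes `0, …, N` is invertible. -/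
theorem exists_moments (N : ℕ) {k : ℕ} (hk : k ≤ N) : ∃ c : Fin (N + 1) → ℝ, ∀ a ≤ N,
    ∑ p, c p * (p : ℝ) ^ a = if a = k then 1 else 0 := by
  set V := Matrix.vandermonde fun p : Fin (N + 1) => (p : ℝ)
  have hV : IsUnit V.det := by
    rw [isUnit_iff_ne_zero, Matrix.det_vandermonde_ne_zero_iff]
    intro i j h
    exact Fin.ext (Nat.cast_injective (R := ℝ) h)
  refine ⟨Matrix.vecMul (Pi.single ⟨k, Nat.lt_succ_of_le hk⟩ 1) V⁻¹, fun a ha => ?_⟩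
  have h : Matrix.vecMul (Matrix.vecMul (Pi.single ⟨k, Nat.lt_succ_of_le hk⟩ 1) V⁻¹) V =
      Pi.single ⟨k, Nat.lt_succ_of_le hk⟩ 1 := by
    rw [Matrix.vecMul_vecMul, Matrix.nonsing_inv_mul _ hV, Matrix.vecMul_one]
  have h' := congrFun h ⟨a, Nat.lt_succ_of_le ha⟩
  simpa [Matrix.vecMul, dotProduct, V, Matrix.vandermonde_apply, Pi.single_apply] using h'

/-- A linear combination of lattice ridge monomials that isolates a single monomial. -/
theorem exists_ridge_moments {q N : ℕ} {k : Fin q → ℕ} (hk : ∀ i, k i ≤ N) :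
    ∃ (c : (Fin q → Fin (N + 1)) → ℝ) (κ : ℝ), κ ≠ 0 ∧ ∀ (x : Fin q → ℝ), ∀ j ≤ ∑ i, k i,
      ∑ p, c p * (∑ i, (p i : ℝ) * x i) ^ j =
        if j = ∑ i, k i then κ * ∏ i, x i ^ k i else 0 := by
  choose c hc using fun i => exists_moments N (hk i)
  refine ⟨fun p => ∏ i, c i (p i), Nat.multinomial univ k,
    by exact_mod_cast (Nat.multinomial_pos _ _).ne', fun x j hj => ?_⟩
  have e : ∑ p : Fin q → Fin (N + 1), (∏ i, c i (p i)) * (∑ i, (p i : ℝ) * x i) ^ j =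
      ∑ a ∈ piAntidiag univ j, (Nat.multinomial univ a : ℝ) *
        ∏ i, (x i ^ a i * ∑ p : Fin (N + 1), c i p * (p : ℝ) ^ a i) := by
    simp only [sum_pow_eq_sum_piAntidiag, mul_sum, prod_univ_sum, Fintype.piFinset_univ]
    rw [sum_comm]
    refine sum_congr rfl fun a _ => sum_congr rfl fun p _ => ?_
    rw [mul_left_comm, ← prod_mul_distrib]
    congr 1
    refine prod_congr rfl fun i _ => ?_
    rw [mul_pow]; ring
  rw [e]
  -- An exponent `a ≠ k` of total degree at most that of `k` has some `a i < k i`, and that moment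
  -- vanishes. Larger exponents, possibly above `N`, need no control.
  have hzero : ∀ a ∈ piAntidiag (univ : Finset (Fin q)) j, a ≠ k →
      (Nat.multinomial univ a : ℝ) *
        ∏ i, (x i ^ a i * ∑ p : Fin (N + 1), c i p * (p : ℝ) ^ a i) = 0 := by
    intro a ha hak
    rw [mem_piAntidiag] at ha
    obtain ⟨i, hi⟩ : ∃ i, a i < k i := by
      by_contra! hcon
      refine hak (funext fun i => ?_)
      have := (sum_eq_sum_iff_of_le fun i (_ : i ∈ univ) => hcon i).1
        (le_antisymm (sum_le_sum fun i _ => hcon i) (ha.1.trans_le hj))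
      exact (this i (mem_univ i)).symm
    refine mul_eq_zero_of_right _ (prod_eq_zero (mem_univ i) ?_)
    rw [hc i _ (hi.le.trans (hk i)), if_neg hi.ne, mul_zero]
  split_ifs with h
  · rw [sum_eq_single_of_mem k (by simp [h]) hzero]
    congr 1
    refine prod_congr rfl fun i _ => ?_
    rw [hc i _ (hk i), if_pos rfl, mul_one]
  · refine sum_eq_zero fun a ha => hzero a ha ?_
    rintro rfl
    rw [mem_piAntidiag] at ha
    exact h ha.1.symm

theorem abs_ridge_le {q N : ℕ} (p : Fin q → Fin (N + 1)) {x : Fin q → ℝ} (hx : x ∈ cube q) :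
    |∑ i, (p i : ℝ) * x i| ≤ q * N := by
  refine (abs_sum_le_sum_abs _ _).trans ?_
  refine (sum_le_sum (g := fun _ => (N : ℝ)) fun i _ => ?_).trans (by simp)
  rw [abs_mul, Nat.abs_cast]
  have h1 : ((p i : ℕ) : ℝ) ≤ N := by exact_mod_cast Nat.lt_succ_iff.1 (p i).2
  have h2 : |x i| ≤ 1 := abs_le.2 ⟨hx.1 i, hx.2 i⟩
  calc _ ≤ (N : ℝ) * 1 := by gcongr
    _ = N := mul_one _

/-- The weights cancel all Taylor terms at `b` of order below `m` and leave `d * h ^ m` times the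
monomial; after division the remainder is `o(1)`. Only the outer coefficients `a` depend on `k`. -/
theorem eventually_monomial_approx {σ : ℝ → ℝ} (hσ : ContDiff ℝ ∞ σ) {b : ℝ}
    (hb : ∀ n : ℕ, iteratedDeriv n σ b ≠ 0) {q N : ℕ} {k : Fin q → ℕ} (hk : ∀ i, k i ≤ N)
    {δ : ℝ} (hδ : 0 < δ) : ∀ᶠ h in 𝓝[>] (0 : ℝ), ∃ a : (Fin q → Fin (N + 1)) → ℝ,
      ∀ x ∈ cube q, |∏ i, x i ^ k i - ∑ p, a p * σ ((∑ i, h * (p i : ℝ) * x i) + b)| ≤ δ := by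
  obtain ⟨c, κ, hκ, hc⟩ := exists_ridge_moments hk
  set m := ∑ i, k i with hm
  set R : ℝ := q * N + 1 with hR
  have hR0 : 0 < R := by positivity
  set B : ℝ := ∑ p, |c p| with hB
  have hB0 : 0 ≤ B := sum_nonneg fun _ _ => abs_nonneg _
  set d : ℝ := (m.factorial : ℝ)⁻¹ * iteratedDeriv m σ b * κ with hd
  have hd0 : d ≠ 0 := by have := hb m; positivity
  -- Tolerance for the Taylor remainder: arguments deviate from `b` by at most `h * R`, and the
  -- coefficients have total mass `B`.
  have hη : 0 < δ * |d| / ((B + 1) * R ^ m) := by positivity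
  have hT := (taylor_isLittleO_univ (x₀ := b) (n := m)
    (hσ.of_le (by exact_mod_cast le_top))).def hη
  obtain ⟨ρ, hρ, hT⟩ := Metric.eventually_nhds_iff.1 hT
  filter_upwards [Ioo_mem_nhdsGT (div_pos hρ hR0)] with h hh
  have hh0 : 0 < h := hh.1
  have hhρ : h * R < ρ := (lt_div_iff₀ hR0).1 hh.2
  refine ⟨fun p => c p / (d * h ^ m), fun x hx => ?_⟩
  have hs : ∀ p : Fin q → Fin (N + 1), ∑ i, h * (p i : ℝ) * x i = h * ∑ i, (p i : ℝ) * x i :=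
    fun p => by simp only [mul_sum, mul_assoc]
  have hle : ∀ p : Fin q → Fin (N + 1), |h * ∑ i, (p i : ℝ) * x i| ≤ h * R := fun p => by
    rw [abs_mul, abs_of_pos hh0]
    have := abs_ridge_le p hx
    gcongr; linarith
  have htay : ∑ p, c p * taylorWithinEval σ m Set.univ b ((∑ i, h * (p i : ℝ) * x i) + b) =
      d * h ^ m * ∏ i, x i ^ k i := by
    simp only [taylor_within_apply, add_sub_cancel_right, hs, mul_pow, smul_eq_mul,
      iteratedDerivWithin_univ]
    simp only [mul_sum (range (m + 1))]
    rw [sum_comm]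
    have : ∀ j ∈ range (m + 1), ∑ p : Fin q → Fin (N + 1), c p * ((j.factorial : ℝ)⁻¹ *
        (h ^ j * (∑ i, (p i : ℝ) * x i) ^ j) * iteratedDeriv j σ b) =
        (j.factorial : ℝ)⁻¹ * h ^ j * iteratedDeriv j σ b *
          if j = m then κ * ∏ i, x i ^ k i else 0 := by
      intro j hj
      rw [← hc x j (Nat.lt_succ_iff.1 (mem_range.1 hj)), mul_sum]
      exact sum_congr rfl fun p _ => by ring
    rw [sum_congr rfl this]
    simp only [mul_ite, mul_zero]
    rw [sum_ite_eq', if_pos (mem_range.2 (Nat.lt_succ_self m)), hd]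
    ring
  have hden : 0 < |d| * h ^ m := by positivity
  have e : ∏ i, x i ^ k i - ∑ p, c p / (d * h ^ m) * σ ((∑ i, h * (p i : ℝ) * x i) + b) =
      -(∑ p, c p * (σ ((∑ i, h * (p i : ℝ) * x i) + b) -
        taylorWithinEval σ m Set.univ b ((∑ i, h * (p i : ℝ) * x i) + b))) / (d * h ^ m) := by
    simp only [mul_sub, sum_sub_distrib, htay]
    rw [sum_congr rfl fun p _ => div_mul_eq_mul_div (c p) (d * h ^ m) _, ← sum_div]
    have := hh0.ne'
    field_simp
    ring
  rw [e, abs_div, abs_neg, abs_mul, abs_pow, abs_of_pos hh0, div_le_iff₀ hden]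
  calc _ ≤ ∑ p, |c p| * (δ * |d| / ((B + 1) * R ^ m) * (h * R) ^ m) := by
        refine (abs_sum_le_sum_abs _ _).trans (sum_le_sum fun p _ => ?_)
        rw [abs_mul]
        gcongr
        have := hT (y := (∑ i, h * (p i : ℝ) * x i) + b) (by
          rw [Real.dist_eq, add_sub_cancel_right, hs]; exact (hle p).trans_lt hhρ)
        rw [Real.norm_eq_abs, norm_pow, Real.norm_eq_abs, add_sub_cancel_right, hs] at this
        rw [hs]
        refine this.trans ?_
        gcongr; exact hle p
    _ = B / (B + 1) * (δ * (|d| * h ^ m)) := by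
        rw [← sum_mul, ← hB, mul_pow]; field_simp
    _ ≤ 1 * (δ * (|d| * h ^ m)) := by
        gcongr
        rw [div_le_one (by positivity)]; linarith
    _ = _ := one_mul _

/-- Stating the approximation for all small `h` lets summands share one `h`, hence the same units,
so adding monomials costs no units. -/
theorem eventually_coordPoly_approx {σ : ℝ → ℝ} (hσ : ContDiff ℝ ∞ σ) {b : ℝ}
    (hb : ∀ n : ℕ, iteratedDeriv n σ b ≠ 0) {q N : ℕ} {P : (Fin q → ℝ) → ℝ}
    (hP : P ∈ coordPoly N univ) :
    ∀ δ > 0, ∀ᶠ h in 𝓝[>] (0 : ℝ), ∃ a : (Fin q → Fin (N + 1)) → ℝ,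
      ∀ x ∈ cube q, |P x - ∑ p, a p * σ ((∑ i, h * (p i : ℝ) * x i) + b)| ≤ δ := by
  induction hP using Submodule.span_induction with
  | zero => exact fun δ hδ => Eventually.of_forall fun h => ⟨0, fun x _ => by simpa using hδ.le⟩
  | add f g _ _ hf hg =>
    intro δ hδ
    filter_upwards [hf (δ / 2) (by linarith), hg (δ / 2) (by linarith)] with h ⟨a, ha⟩ ⟨a', ha'⟩
    refine ⟨a + a', fun x hx => ?_⟩
    have h1 := abs_le.1 (ha x hx)
    have h2 := abs_le.1 (ha' x hx)
    simp only [Pi.add_apply, add_mul, sum_add_distrib]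
    rw [abs_le]; constructor <;> linarith
  | smul z f _ hf =>
    intro δ hδ
    filter_upwards [hf (δ / (|z| + 1)) (by positivity)] with h ⟨a, ha⟩
    refine ⟨z • a, fun x hx => ?_⟩
    simp only [Pi.smul_apply, smul_eq_mul, mul_assoc z, ← mul_sum]
    rw [← mul_sub, abs_mul]
    have h1 := ha x hx
    rw [le_div_iff₀ (by positivity)] at h1
    nlinarith [abs_nonneg (f x - ∑ p, a p * σ ((∑ i, h * (p i : ℝ) * x i) + b))]
  | mem f hf =>
    obtain ⟨k, hk, rfl⟩ := hf
    exact fun δ hδ => eventually_monomial_approx hσ hb hk hδ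

theorem sum_mem_shallow (σ : ℝ → ℝ) {n q : ℕ} {ι : Type*} [Fintype ι] (hn : Fintype.card ι ≤ n)
    (a : ι → ℝ) (w : ι → Fin q → ℝ) (b : ι → ℝ) :
    (fun x => ∑ k, a k * σ ((∑ i, w k i * x i) + b k)) ∈ shallow σ n q := by
  obtain ⟨e⟩ : Nonempty (ι ↪ Fin n) := Function.Embedding.nonempty_of_card_le (by simpa using hn)
  refine ⟨Function.extend e a 0, Function.extend e w 0, Function.extend e b 0, ?_⟩
  ext x
  refine Fintype.sum_of_injective e e.injective _ _ (fun k hk => ?_) (fun k => ?_)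
  · rw [Function.extend_apply' _ _ _ (by simpa using hk)]; simp
  · simp [e.injective.extend_apply]

theorem smul_mem_shallow {σ : ℝ → ℝ} {n q : ℕ} {P : (Fin q → ℝ) → ℝ} (hP : P ∈ shallow σ n q)
    (c : ℝ) : (fun x => c * P x) ∈ shallow σ n q := by
  obtain ⟨a, w, b, rfl⟩ := hP
  exact ⟨fun k => c * a k, w, b, by ext; simp only [mul_sum, mul_assoc]⟩

theorem exists_shallow_approx {σ : ℝ → ℝ} (hσ : ContDiff ℝ ∞ σ)
    (hpoly : ∀ a b : ℝ, a < b → ¬ ∃ p : Polynomial ℝ, ∀ x ∈ Set.Ioo a b, σ x = p.eval x)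
    {q N n : ℕ} (hn : (N + 1) ^ q ≤ n) {P : (Fin q → ℝ) → ℝ} (hP : P ∈ coordPoly N univ)
    {δ : ℝ} (hδ : 0 < δ) : ∃ S ∈ shallow σ n q, ∀ x ∈ cube q, |P x - S x| ≤ δ := by
  obtain ⟨b, hb⟩ := exists_iteratedDeriv_ne_zero hσ hpoly
  obtain ⟨h, a, ha⟩ := (eventually_coordPoly_approx hσ hb hP δ hδ).exists
  exact ⟨_, sum_mem_shallow σ (by simpa using hn) a (fun p i => h * (p i : ℝ)) fun _ => b, ha⟩

/-! ### Rates for shallow and deep networks -/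

theorem exists_shallow_rate {σ : ℝ → ℝ} (hσ : ContDiff ℝ ∞ σ)
    (hpoly : ∀ a b : ℝ, a < b → ¬ ∃ p : Polynomial ℝ, ∀ x ∈ Set.Ioo a b, σ x = p.eval x)
    {r q : ℕ} (hr : 1 ≤ r) (hq : 1 ≤ q) : ∃ C : ℝ, 0 ≤ C ∧
      ∀ f ∈ smoothBall r q, ∀ n : ℕ, 1 ≤ n → ∃ S ∈ shallow σ n q, ∀ x ∈ cube q,
        |f x - S x| ≤ C * (n : ℝ) ^ (-((r : ℝ) / (q : ℝ))) := by
  obtain ⟨D, hD, h⟩ := exists_coordPoly_approx hr q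
  -- Chosen so that the Jackson degree plus one is at most `(L + 1) * A`; with `L + 1 = ⌊s / A⌋₊`
  -- the unit count is then at most `s ^ q = n`.
  set A : ℕ := 2 * (r + 2) + r + 1 with hA
  have hA0 : (0 : ℝ) < A := by positivity
  refine ⟨D * (2 * A) ^ r + 1 + A ^ r, by positivity, fun f hf n hn => ?_⟩
  have hn0 : (0 : ℝ) < n := by exact_mod_cast hn
  set s : ℝ := (n : ℝ) ^ (1 / (q : ℝ)) with hs
  have hs0 : 0 < s := Real.rpow_pos_of_pos hn0 _
  have hq0 : (q : ℝ) ≠ 0 := by positivity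
  have hsq : s ^ q = n := by
    rw [hs, ← Real.rpow_natCast, ← Real.rpow_mul hn0.le, one_div_mul_cancel hq0, Real.rpow_one]
  have hrate : (n : ℝ) ^ (-((r : ℝ) / (q : ℝ))) = (s ^ r)⁻¹ := by
    rw [Real.rpow_neg hn0.le, hs, ← Real.rpow_natCast _ r, ← Real.rpow_mul hn0.le]
    congr 2; ring
  rw [hrate]
  -- For small `n` the zero network suffices, at the price of the term `A ^ r` in the constant.
  rcases lt_or_ge s A with hsA | hsA
  · refine ⟨fun x => ∑ k : Fin n, 0 * σ ((∑ i, 0 * x i) + 0), ⟨0, 0, 0, rfl⟩, fun x hx => ?_⟩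
    have h1 := abs_le_one_of_mem_smoothBall hf hx
    simp only [zero_mul, sum_const_zero, sub_zero]
    refine h1.trans ?_
    rw [← div_eq_mul_inv, one_le_div (by positivity)]
    have : s ^ r ≤ (A : ℝ) ^ r := by gcongr
    have : 0 ≤ D * (2 * A : ℝ) ^ r := by positivity
    linarith
  · obtain ⟨L, hL⟩ : ∃ L, ⌊s / A⌋₊ = L + 1 :=
      Nat.exists_eq_succ_of_ne_zero (Nat.floor_pos.2 ((one_le_div hA0).2 hsA)).ne'
    have hL1 : ((L : ℝ) + 1) * A ≤ s := by
      have := Nat.floor_le (div_pos hs0 hA0).le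
      rw [hL, le_div_iff₀ hA0] at this
      exact_mod_cast this
    have hL2 : s ≤ ((L : ℝ) + 1) * (2 * A) := by
      have := (Nat.lt_floor_add_one (s / A)).le
      rw [hL, div_le_iff₀ hA0] at this
      push_cast at this
      nlinarith [mul_nonneg (Nat.cast_nonneg (α := ℝ) L) hA0.le]
    obtain ⟨P, hP, hfP⟩ := h f hf L
    obtain ⟨S, hS, hPS⟩ := exists_shallow_approx hσ hpoly (n := n) (by
      have h1 : (2 * (r + 2) * L + r + 1) ≤ (L + 1) * A := by rw [hA]; nlinarith
      have h2 : (((L + 1) * A : ℕ) : ℝ) ^ q ≤ n := by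
        rw [← hsq]; gcongr; exact_mod_cast hL1
      exact (Nat.pow_le_pow_left h1 q).trans (by exact_mod_cast h2)) hP (inv_pos.2 (pow_pos hs0 r))
    refine ⟨S, hS, fun x hx => (abs_sub_le _ _ _).trans
      (add_le_add (hfP x hx) (hPS x hx) |>.trans ?_)⟩
    have h3 : D / ((L : ℝ) + 1) ^ r ≤ D * (2 * A) ^ r * (s ^ r)⁻¹ := by
      rw [← div_eq_mul_inv, div_le_div_iff₀ (by positivity) (by positivity), mul_assoc, ← mul_pow]
      gcongr
      linarith
    have h4 : 0 ≤ (A : ℝ) ^ r * (s ^ r)⁻¹ := by positivity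
    linarith

/-! ### Error propagation through the tree -/

theorem vec_mem_cube {a b : ℝ} (ha : |a| ≤ 1) (hb : |b| ≤ 1) : ![a, b] ∈ cube 2 := by
  rw [abs_le] at ha hb
  refine ⟨fun i => ?_, fun i => ?_⟩ <;> fin_cases i
  · exact ha.1
  · exact hb.1
  · exact ha.2
  · exact hb.2

theorem abs_sub_le_of_mem_smoothBall_two {r : ℕ} (hr : 1 ≤ r) {h : (Fin 2 → ℝ) → ℝ}
    (hh : h ∈ smoothBall r 2) {a b c d : ℝ} (ha : |a| ≤ 1) (hb : |b| ≤ 1) (hc : |c| ≤ 1)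
    (hd : |d| ≤ 1) : |h ![a, b] - h ![c, d]| ≤ |a - c| + |b - d| := by
  have h1 := abs_sub_update_le hr hh (vec_mem_cube ha hb) 0 (abs_le.1 ha) (abs_le.1 hc)
  have h2 := abs_sub_update_le hr hh (vec_mem_cube hc hb) 1 (abs_le.1 hb) (abs_le.1 hd)
  have e1 : ∀ z, Function.update ![a, b] 0 z = ![z, b] := fun z => by
    ext i; fin_cases i <;> simp
  have e2 : ∀ z, Function.update ![c, b] 1 z = ![c, z] := fun z => by
    ext i; fin_cases i <;> simp
  rw [e1, e1] at h1
  rw [e2, e2] at h2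
  exact (abs_sub_le _ _ _).trans (add_le_add h1 h2)

theorem abs_le_one_of_mem_compClass {r q : ℕ} {T : BinTree q} {f : (Fin q → ℝ) → ℝ}
    (hf : f ∈ compClass (smoothBall r 2) T) {x : Fin q → ℝ} (hx : x ∈ cube q) : |f x| ≤ 1 := by
  induction T generalizing f with
  | leaf i =>
    obtain rfl : f = fun x => x i := hf
    exact abs_le.2 ⟨hx.1 i, hx.2 i⟩
  | node T₁ T₂ ihl ihr =>
    obtain ⟨h, hh, g₁, hg₁, g₂, hg₂, rfl⟩ := hf
    exact abs_le_one_of_mem_smoothBall hh (vec_mem_cube (ihl hg₁) (ihr hg₂))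

/-- The bound `|S x| ≤ 1` is carried through the induction because constituents are controlled only
on the square. -/
theorem exists_deep_rate {σ : ℝ → ℝ} (hσ : ContDiff ℝ ∞ σ)
    (hpoly : ∀ a b : ℝ, a < b → ¬ ∃ p : Polynomial ℝ, ∀ x ∈ Set.Ioo a b, σ x = p.eval x)
    {r q : ℕ} (hr : 1 ≤ r) (T : BinTree q) : ∃ C : ℝ, 0 ≤ C ∧
      ∀ f ∈ compClass (smoothBall r 2) T, ∀ n : ℕ, 1 ≤ n →
        ∃ S ∈ compClass (shallow σ n 2) T, ∀ x ∈ cube q,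
          |S x| ≤ 1 ∧ |f x - S x| ≤ C * (n : ℝ) ^ (-((r : ℝ) / 2)) := by
  induction T with
  | leaf i =>
    refine ⟨0, le_rfl, fun f hf n _ => ⟨fun x => x i, rfl, fun x hx => ?_⟩⟩
    obtain rfl : f = fun x => x i := hf
    exact ⟨abs_le.2 ⟨hx.1 i, hx.2 i⟩, by simp⟩
  | node T₁ T₂ ihl ihr =>
    obtain ⟨C₁, hC₁, ihl⟩ := ihl
    obtain ⟨C₂, hC₂, ihr⟩ := ihr
    obtain ⟨C, hC, hsh⟩ := exists_shallow_rate hσ hpoly hr one_le_two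
    refine ⟨C₁ + C₂ + 2 * C, by positivity, ?_⟩
    rintro f ⟨h, hh, g₁, hg₁, g₂, hg₂, rfl⟩ n hn
    obtain ⟨S₁, hS₁, h₁⟩ := ihl g₁ hg₁ n hn
    obtain ⟨S₂, hS₂, h₂⟩ := ihr g₂ hg₂ n hn
    obtain ⟨S, hS, hhS⟩ := hsh h hh n hn
    norm_num only [Nat.cast_ofNat] at hhS
    set η : ℝ := (n : ℝ) ^ (-((r : ℝ) / 2)) with hη
    have hε : 0 ≤ C * η := by positivity
    -- The network may overshoot `[-1,1]` by `C * η`. Dividing by `1 + C * η` corrects this and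
    -- costs at most another `C * η`, whence `2 * C` in the constant.
    refine ⟨_, ⟨_, smul_mem_shallow hS (1 + C * η)⁻¹, S₁, hS₁, S₂, hS₂, rfl⟩, fun x hx => ?_⟩
    obtain ⟨b₁, e₁⟩ := h₁ x hx
    obtain ⟨b₂, e₂⟩ := h₂ x hx
    have hc := vec_mem_cube b₁ b₂
    have e₃ := hhS _ hc
    have b₃ := abs_le_one_of_mem_smoothBall hh hc
    have e₄ := abs_sub_le_of_mem_smoothBall_two hr hh (abs_le_one_of_mem_compClass hg₁ hx)
      (abs_le_one_of_mem_compClass hg₂ hx) b₁ b₂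
    set y := S ![S₁ x, S₂ x]
    have b₄ : |y| ≤ 1 + C * η := by
      rw [abs_le] at e₃ b₃ ⊢; constructor <;> linarith
    set z := (1 + C * η)⁻¹ * y with hz
    have hy : y = (1 + C * η) * z := by rw [hz, mul_inv_cancel_left₀ (by positivity)]
    have b₅ : |z| ≤ 1 := by
      rw [hy, abs_mul, abs_of_pos (by positivity : 0 < 1 + C * η)] at b₄
      exact le_of_mul_le_mul_left (by linarith) (by positivity : 0 < 1 + C * η)
    refine ⟨b₅, ?_⟩
    have e₅ : |y - z| ≤ C * η := by
      rw [hy, show (1 + C * η) * z - z = C * η * z by ring, abs_mul, abs_of_nonneg hε]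
      exact mul_le_of_le_one_right hε b₅
    refine (abs_sub_le _ (h ![S₁ x, S₂ x]) _).trans ((add_le_add e₄ (abs_sub_le _ y _)).trans ?_)
    linarith

end DeepNet

/-- Degree of approximation by shallow networks and by deep networks with the structure of a
binary tree, for a smooth activation function that is nowhere locally a polynomial. -/
theorem theorem1 (σ : ℝ → ℝ) (hσ : ContDiff ℝ ∞ σ)
    (hpoly : ∀ a b : ℝ, a < b → ¬ ∃ p : Polynomial ℝ, ∀ x ∈ Set.Ioo a b, σ x = p.eval x)
    (r : ℕ) (hr : 1 ≤ r) :
    (∀ q : ℕ, 1 ≤ q → ∃ C : ℝ, ∀ f ∈ DeepNet.smoothBall r q, ∀ n : ℕ, 1 ≤ n →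
      DeepNet.unifDist f (DeepNet.shallow σ n q) ≤
        ENNReal.ofReal (C * (n : ℝ) ^ (-((r : ℝ) / (q : ℝ))))) ∧
    (∀ (q : ℕ) (T : DeepNet.BinTree q), ∃ C : ℝ,
      ∀ f ∈ DeepNet.compClass (DeepNet.smoothBall r 2) T, ∀ n : ℕ, 1 ≤ n →
        DeepNet.unifDist f (DeepNet.compClass (DeepNet.shallow σ n 2) T) ≤
          ENNReal.ofReal (C * (n : ℝ) ^ (-((r : ℝ) / 2)))) := by
  refine ⟨fun q hq => ?_, fun q T => ?_⟩
  · obtain ⟨C, -, h⟩ := DeepNet.exists_shallow_rate hσ hpoly hr hq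
    refine ⟨C, fun f hf n hn => ?_⟩
    obtain ⟨S, hS, hfS⟩ := h f hf n hn
    exact DeepNet.unifDist_le hS hfS
  · obtain ⟨C, -, h⟩ := DeepNet.exists_deep_rate hσ hpoly hr T
    refine ⟨C, fun f hf n hn => ?_⟩
    obtain ⟨S, hS, hfS⟩ := h f hf n hn
    exact DeepNet.unifDist_le hS fun x hx => (hfS x hx).2
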